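/- Alphabets are finite and non-empty. The (left) quotient of a language $L\subseteq\Sigma^*$ by a word $w$ is $L_w=\{x\in\Sigma^* : wx\in L\}$. The quotient DFA of a regular language $L$ has the quotients of $L$ as states, transitions $\delta(L_w,a)=L_{wa}$, initial state $L$, and final states those $L_w$ that contain $\varepsilon$. A state of a DFA is empty if no word is accepted from it; the quotient IDFA of $L$ is the incomplete automaton obtained from the quotient DFA by removing the empty state (if present) and all transitions incident to it. The transition semigroup of a DFA (respectively IDFA) is the set of all transformations (respectively partial transformations) of its state set performed by non-empty words. * A DFA or IDFA is monotonic if there is one total order $\le$ on its states such that every $t$ in its transition semigroup satisfies: $p\le q$ implies $pt\le qt$ for all $p,q$ in the domain of $t$. * A DFA is partially monotonic if the IDFA obtained by removing its empty state (if any) is monotonic. * An input letter is constant if it maps all states to the same state. A DFA is nearly monotonic if it becomes partially monotonic after all constant input letters are removed from the alphabet. * A regular language is monotonic (respectively nearly monotonic) if its quotient DFA is; it is partially monotonic if its quotient IDFA is monotonic. * The star-free languages over $\Sigma$ are the smallest class of languages that contains $\emptyset$, $\{\varepsilon\}$ and $\{a\}$ for $a\in\Sigma$, and is closed under boolean operations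 and product. Let $\mathbb L_M,\mathbb L_{PM},\mathbb L_{NM},\mathbb L_{SF}$ be the classes of monotonic, partially monotonic, nearly monotonic and star-free languages, over all alphabets. **Proposition.** $$\mathbb L_M\subsetneq\mathbb L_{PM}\subsetneq\mathbb L_{NM}\subsetneq\mathbb L_{SF}.$$ Moreover, writing $[i_1,i_2,i_3]$ for the transformation $1\mapsto i_1$, $2\mapsto i_2$, $3\mapsto i_3$ of the state set $\{1,2,3\}$ with initial state $1$: 1. the language of the DFA with inputs $a=[3,1,3]$, $b=[2,3,3]$, $c=[2,2,3]$ and final state $1$ is in $\mathbb L_{PM}\setminus\mathbb L_M$; 2. the language of the DFA with inputs $a=[3,1,3]$, $b=[2,3,3]$, $c=[2,2,3]$, $d=[1,1,1]$ and final state $1$ is in $\mathbb L_{NM}\setminus\mathbb L_{PM}$; 3. the language of the DFA with inputs $a=[3,2,2]$, $b=[2,3,3]$ and final state $3$ is in $\mathbb L_{SF}\setminus\mathbb L_{NM}$. -/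

import Mathlib

/-! ### Complete deterministic automata -/

/-- The transformation of the state set performed by the word `w`. -/
def DFA.transformation {α σ : Type*} (M : DFA α σ) (w : List α) : σ → σ :=
  fun q => M.evalFrom q w

/-- The transition semigroup: all transformations performed by non-empty words. -/
def DFA.transitionSemigroup {α σ : Type*} (M : DFA α σ) : Set (σ → σ) :=
  {t | ∃ w : List α, w ≠ [] ∧ t = M.transformation w}

/-- A DFA is monotonic if all transformations in its transition semigroup are monotonic with respect
to one fixed total order on the states. -/
def DFA.IsMonotonic {α σ : Type*} (M : DFA α σ) : Prop :=
  ∃ _ : LinearOrder σ, ∀ t ∈ M.transitionSemigroup, ∀ p q : σ, p ≤ q → t p ≤ t q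

/-! ### Incomplete deterministic automata -/

/-- An incomplete deterministic automaton; `none` stands for an undefined transition. The initial
state is an `Option` because removing the empty state from the quotient DFA of the empty
language removes the initial state. -/
structure IDFA (α σ : Type*) where
  /-- The partial transition function. -/
  step : σ → α → Option σ
  /-- The initial state. -/
  start : Option σ
  /-- The final states. -/
  accept : Set σ

/-- The partial transformation of the state set performed by a word. -/
def IDFA.transformation {α σ : Type*} (M : IDFA α σ) : List α → σ → Option σ
  | [], q => some q
  | a :: w, q => (M.step q a).bind (M.transformation w)

/-- The transition semigroup: all partial transformations performed by non-empty words. -/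
def IDFA.transitionSemigroup {α σ : Type*} (M : IDFA α σ) : Set (σ → Option σ) :=
  {t | ∃ w : List α, w ≠ [] ∧ t = M.transformation w}

/-- An IDFA is monotonic if all partial transformations in its transition semigroup are monotonic
on their domains with respect to one fixed total order on the states. -/
def IDFA.IsMonotonic {α σ : Type*} (M : IDFA α σ) : Prop :=
  ∃ _ : LinearOrder σ, ∀ t ∈ M.transitionSemigroup,
    ∀ p q p' q' : σ, t p = some p' → t q = some q' → p ≤ q → p' ≤ q'

/-! ### Partially and nearly monotonic automata -/

/-- A state is empty if no word is accepted from it. -/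
def DFA.IsEmptyState {α σ : Type*} (M : DFA α σ) (q : σ) : Prop :=
  M.acceptsFrom q = 0

open Classical in
/-- The IDFA obtained by removing empty states and all transitions incident to them. -/
noncomputable def DFA.removeEmpty {α σ : Type*} (M : DFA α σ) :
    IDFA α {q : σ // ¬ M.IsEmptyState q} where
  step q a := if h : ¬ M.IsEmptyState (M.step q.1 a) then some ⟨M.step q.1 a, h⟩ else none
  start := if h : ¬ M.IsEmptyState M.start then some ⟨M.start, h⟩ else none
  accept := {q | q.1 ∈ M.accept}

/-- A DFA is partially monotonic if removing its empty state gives a monotonic IDFA. -/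
def DFA.IsPartiallyMonotonic {α σ : Type*} (M : DFA α σ) : Prop :=
  M.removeEmpty.IsMonotonic

/-- An input is constant if it performs a constant transformation of the states. -/
def DFA.IsConstantInput {α σ : Type*} (M : DFA α σ) (a : α) : Prop :=
  ∀ p q : σ, M.step p a = M.step q a

/-- The DFA obtained by removing all constant inputs from the alphabet (keeping all states). -/
def DFA.removeConstantInputs {α σ : Type*} (M : DFA α σ) :
    DFA {a : α // ¬ M.IsConstantInput a} σ where
  step q a := M.step q a.1
  start := M.start
  accept := M.accept

/-- A DFA is nearly monotonic if it is partially monotonic after removing constant inputs. -/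
def DFA.IsNearlyMonotonic {α σ : Type*} (M : DFA α σ) : Prop :=
  M.removeConstantInputs.IsPartiallyMonotonic

/-! ### Languages

Mathlib's `Language.toDFA` is the quotient DFA: its states are the left quotients of the language. -/

/-- The quotient IDFA: the quotient DFA with the empty quotient (if any) removed. -/
noncomputable def Language.quotientIDFA {α : Type*} (L : Language α) :
    IDFA α {q : Set.range L.leftQuotient // ¬ L.toDFA.IsEmptyState q} :=
  L.toDFA.removeEmpty

/-- A regular language is monotonic if its quotient DFA is monotonic. -/
def Language.IsMonotonic {α : Type*} (L : Language α) : Prop :=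
  L.IsRegular ∧ L.toDFA.IsMonotonic

/-- A regular language is partially monotonic if its quotient IDFA is monotonic. -/
def Language.IsPartiallyMonotonic {α : Type*} (L : Language α) : Prop :=
  L.IsRegular ∧ L.quotientIDFA.IsMonotonic

/-- A regular language is nearly monotonic if its quotient DFA is nearly monotonic. -/
def Language.IsNearlyMonotonic {α : Type*} (L : Language α) : Prop :=
  L.IsRegular ∧ L.toDFA.IsNearlyMonotonic

/-- Star-free languages: the smallest class containing the basic languages `∅`, `{ε}`, `{a}` and
closed under boolean operations and product (the remaining boolean operations are generated by
complement and union). -/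
inductive Language.IsStarFree {α : Type*} : Language α → Prop
  | empty : Language.IsStarFree (0 : Language α)
  | epsilon : Language.IsStarFree (1 : Language α)
  | letter (a : α) : Language.IsStarFree ({[a]} : Set (List α))
  | compl {K : Language α} : Language.IsStarFree K → Language.IsStarFree Kᶜ
  | union {K L : Language α} :
      Language.IsStarFree K → Language.IsStarFree L → Language.IsStarFree (K + L)
  | inter {K L : Language α} :
      Language.IsStarFree K → Language.IsStarFree L → Language.IsStarFree (K ⊓ L)
  | product {K L : Language α} :
      Language.IsStarFree K → Language.IsStarFree L → Language.IsStarFree (K * L)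

/-! ### Classes of languages

A class consists of languages over arbitrary non-empty finite alphabets; an element is a pair of an
alphabet and a language over it. -/

/-- The class of monotonic languages. -/
def classM : Set ((α : Type) × Language α) :=
  {L | Finite L.1 ∧ Nonempty L.1 ∧ L.2.IsMonotonic}

/-- The class of partially monotonic languages. -/
def classPM : Set ((α : Type) × Language α) :=
  {L | Finite L.1 ∧ Nonempty L.1 ∧ L.2.IsPartiallyMonotonic}

/-- The class of nearly monotonic languages. -/
def classNM : Set ((α : Type) × Language α) :=
  {L | Finite L.1 ∧ Nonempty L.1 ∧ L.2.IsNearlyMonotonic}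

/-- The class of star-free languages. -/
def classSF : Set ((α : Type) × Language α) :=
  {L | Finite L.1 ∧ Nonempty L.1 ∧ L.2.IsStarFree}

/-! ### Three explicit automata

States `1, 2, 3` are `0, 1, 2 : Fin 3`, and letters `a, b, c, d` are `0, 1, 2, 3`. Row `x` of the
table lists the images of the three states under the letter `x`. -/

/-- `a = [3,1,3]`, `b = [2,3,3]`, `c = [2,2,3]`; initial state `1`, final state `1`. -/
def dfaPMnotM : DFA (Fin 3) (Fin 3) where
  step q x := (![![2, 0, 2], ![1, 2, 2], ![1, 1, 2]] : Fin 3 → Fin 3 → Fin 3) x q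
  start := 0
  accept := {0}

/-- The previous automaton with the additional input `d = [1,1,1]`. -/
def dfaNMnotPM : DFA (Fin 4) (Fin 3) where
  step q x := (![![2, 0, 2], ![1, 2, 2], ![1, 1, 2], ![0, 0, 0]] : Fin 4 → Fin 3 → Fin 3) x q
  start := 0
  accept := {0}

/-- `a = [3,2,2]`, `b = [2,3,3]`; initial state `1`, final state `3`. -/
def dfaSFnotNM : DFA (Fin 2) (Fin 3) where
  step q x := (![![2, 1, 1], ![1, 2, 2]] : Fin 2 → Fin 3 → Fin 3) x q
  start := 0
  accept := {2}

/-! The first two inclusions are soft: an order on all states restricts to the non-empty ones, and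
removing letters leaves fewer transformations and possibly more empty states.

The inclusion in the star-free languages rests on counter-freeness. In a nearly monotonic minimal
DFA, a word containing a constant letter acts as a constant map, so its periodic points are fixed.
For any other word, the orbit of a periodic point either consists of empty states, of which
minimality allows only one, or avoids them and is a monotone periodic sequence, hence constant
(`DFA.IsNearlyMonotonic.isCounterFree`).

Finite counter-free automata accept star-free languages (`DFA.IsCounterFree.isStarFree_aux`). A
letter `c` acting non-trivially cannot permute the states, so its image is smaller. Cutting words at
the occurrences of `c` turns the part between the first and last `c` into a word read by a
counter-free automaton on that image; the other factors avoid `c`. Star-free descriptions are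
carried back along this recoding by `Language.IsStarFree.blockConcat_image`.

Strictness is checked on the three tables, which are isomorphic to the quotient DFAs of their
languages. -/

/-! ### Closure properties of star-free languages -/

namespace Language.IsStarFree

variable {α : Type*}

theorem congr {K L : Language α} (hK : K.IsStarFree) (h : ∀ w, w ∈ L ↔ w ∈ K) : L.IsStarFree := by
  have : L = K := Language.ext h
  rwa [this]

theorem univ : Language.IsStarFree (⊤ : Language α) :=
  (empty.compl).congr fun _ => ⟨fun _ => id, fun _ => trivial⟩

theorem finite_exists {ι : Type*} [Finite ι] {K : ι → Language α} (h : ∀ i, (K i).IsStarFree) :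
    Language.IsStarFree ({w | ∃ i, w ∈ K i} : Set (List α)) := by
  classical
  have := Fintype.ofFinite ι
  have key : ∀ s : Finset ι, Language.IsStarFree ({w | ∃ i ∈ s, w ∈ K i} : Set (List α)) := by
    intro s
    induction s using Finset.induction_on with
    | empty => exact empty.congr fun w => ⟨fun ⟨i, hi, _⟩ => by simp at hi, fun h => h.elim⟩
    | insert i s _ ih =>
      refine ((h i).union ih).congr fun w => ?_
      constructor
      · rintro ⟨j, hj, hw⟩
        rcases Finset.mem_insert.1 hj with rfl | hj
        · exact Or.inl hw
        · exact Or.inr ⟨j, hj, hw⟩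
      · rintro (hw | ⟨j, hj, hw⟩)
        · exact ⟨i, Finset.mem_insert_self i s, hw⟩
        · exact ⟨j, Finset.mem_insert_of_mem hj, hw⟩
  exact (key Finset.univ).congr fun w =>
    ⟨fun ⟨i, hi⟩ => ⟨i, Finset.mem_univ i, hi⟩, fun ⟨i, _, hi⟩ => ⟨i, hi⟩⟩

/-- The words over a subset of a finite alphabet form a star-free language. -/
theorem forall_mem [Finite α] (B : Set α) :
    Language.IsStarFree ({w | ∀ a ∈ w, a ∈ B} : Set (List α)) := by
  have h : ∀ a : {a // a ∉ B}, Language.IsStarFree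
      ((⊤ : Language α) * (({[a.1]} : Language α) * (⊤ : Language α))) := fun a =>
    univ.product ((letter a.1).product univ)
  refine (finite_exists h).compl.congr fun w => ?_
  have : w ∈ ({w | ∃ a : {a // a ∉ B}, w ∈ (⊤ : Language α) * (({[a.1]} : Language α) *
      (⊤ : Language α))} : Set (List α)) ↔ ∃ a ∈ w, a ∉ B := by
    constructor
    · rintro ⟨⟨a, ha⟩, hw⟩
      obtain ⟨x, -, y, hy, rfl⟩ := Language.mem_mul.1 hw
      obtain ⟨z, hz, y, -, rfl⟩ := Language.mem_mul.1 hy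
      have hz : z = [a] := hz
      exact ⟨a, by simp [hz], ha⟩
    · rintro ⟨a, haw, ha⟩
      obtain ⟨x, y, rfl⟩ := List.append_of_mem haw
      exact ⟨⟨a, ha⟩, Language.append_mem_mul (Set.mem_univ x)
        (Language.append_mem_mul (a := [a]) rfl (Set.mem_univ y))⟩
  have h2 := not_congr this
  push Not at h2
  exact h2.symm

end Language.IsStarFree

/-! ### Words as sequences of blocks -/

/-- The concatenation of the given words, each followed by the letter `c`. -/
def blockConcat {α : Type*} {P : List α → Prop} (c : α) : List {u : List α // P u} → List α
  | [] => []
  | u :: us => u.1 ++ c :: blockConcat c us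

section blockConcat

variable {α : Type*} {B : Set α} {c : α}

theorem blockConcat_append {P : List α → Prop} (us vs : List {u : List α // P u}) :
    blockConcat c (us ++ vs) = blockConcat c us ++ blockConcat c vs := by
  induction us with
  | nil => rfl
  | cons u us ih => simp [blockConcat, ih]

theorem append_cons_inj_of_notMem_of_notMem {u v x y : List α} (hu : c ∉ u) (hv : c ∉ v)
    (h : u ++ c :: x = v ++ c :: y) : u = v ∧ x = y := by
  induction u generalizing v with
  | nil =>
    cases v with
    | nil => exact ⟨rfl, (List.cons.inj h).2⟩
    | cons b v => exact (hv ((List.cons.inj h).1 ▸ List.mem_cons_self)).elim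
  | cons a u ih =>
    cases v with
    | nil => exact (hu ((List.cons.inj h).1 ▸ List.mem_cons_self)).elim
    | cons b v =>
      simp only [List.mem_cons, not_or, List.cons_append, List.cons.injEq] at hu hv h
      obtain ⟨h1, h2⟩ := ih hu.2 hv.2 h.2
      exact ⟨by rw [h.1, h1], h2⟩

/-- Since `c` does not occur inside blocks, it marks their ends. Unique factorization is what makes
complements and intersections compatible with the recoding. -/
theorem blockConcat_injective (hc : c ∉ B) :
    Function.Injective (blockConcat (P := fun u : List α => ∀ a ∈ u, a ∈ B) c) := by
  intro us
  induction us with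
  | nil =>
    rintro (_ | ⟨v, vs⟩) h
    · rfl
    · simp [blockConcat] at h
  | cons u us ih =>
    rintro (_ | ⟨v, vs⟩) h
    · simp [blockConcat] at h
    · have hu : c ∉ u.1 := fun h => hc (u.2 c h)
      have hv : c ∉ v.1 := fun h => hc (v.2 c h)
      obtain ⟨h1, h2⟩ := append_cons_inj_of_notMem_of_notMem hu hv h
      rw [Subtype.ext h1, ih h2]

/-- Reading `w` from its right end, a `c` opens a new empty block, and a letter of `B` extends the
current leftmost block or, before any `c` is met, the remainder `v`. -/
theorem exists_eq_blockConcat_append (w : List α) (hw : ∀ a ∈ w, a ∈ insert c B) :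
    ∃ (us : List {u : List α // ∀ a ∈ u, a ∈ B}) (v : {u : List α // ∀ a ∈ u, a ∈ B}),
      w = blockConcat c us ++ v.1 := by
  induction w with
  | nil => exact ⟨[], ⟨[], by simp⟩, rfl⟩
  | cons a w ih =>
    obtain ⟨us, v, h⟩ := ih fun b hb => hw b (List.mem_cons_of_mem a hb)
    rcases hw a List.mem_cons_self with rfl | ha
    · exact ⟨⟨[], by simp⟩ :: us, v, by simp [blockConcat, h]⟩
    · cases us with
      | nil =>
        refine ⟨[], ⟨a :: v.1, ?_⟩, by simp [blockConcat, h]⟩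
        intro b hb
        rcases List.mem_cons.1 hb with rfl | hb
        exacts [ha, v.2 b hb]
      | cons u us =>
        refine ⟨⟨a :: u.1, ?_⟩ :: us, v, by simp [blockConcat, h]⟩
        intro b hb
        rcases List.mem_cons.1 hb with rfl | hb
        exacts [ha, u.2 b hb]

theorem mem_of_mem_blockConcat (us : List {u : List α // ∀ a ∈ u, a ∈ B}) :
    ∀ a ∈ blockConcat c us, a ∈ insert c B := by
  induction us with
  | nil => simp [blockConcat]
  | cons u us ih =>
    intro a ha
    simp only [blockConcat, List.mem_append, List.mem_cons] at ha
    rcases ha with ha | rfl | ha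
    exacts [Or.inr (u.2 a ha), Or.inl rfl, ih a ha]

theorem blockConcat_eq_nil_or (us : List {u : List α // ∀ a ∈ u, a ∈ B}) :
    blockConcat c us = [] ∨ ∃ x, blockConcat c us = x ++ [c] := by
  induction us with
  | nil => exact Or.inl rfl
  | cons u us ih =>
    right
    rcases ih with h | ⟨x, h⟩
    · exact ⟨u.1, by simp [blockConcat, h]⟩
    · exact ⟨u.1 ++ c :: x, by simp [blockConcat, h]⟩

theorem mem_range_blockConcat (hc : c ∉ B) (w : List α) :
    (∃ us : List {u : List α // ∀ a ∈ u, a ∈ B}, blockConcat c us = w) ↔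
      (∀ a ∈ w, a ∈ insert c B) ∧ (w = [] ∨ ∃ x, w = x ++ [c]) := by
  constructor
  · rintro ⟨us, rfl⟩
    exact ⟨mem_of_mem_blockConcat us, blockConcat_eq_nil_or us⟩
  · rintro ⟨hw, hw'⟩
    obtain ⟨us, ⟨v, hv⟩, rfl⟩ := exists_eq_blockConcat_append w hw
    rcases List.eq_nil_or_concat' v with rfl | ⟨v, b, rfl⟩
    · exact ⟨us, by simp⟩
    -- A non-empty remainder would make the word end in a letter of `B`, not in `c`.
    · exfalso
      rcases hw' with h | ⟨x, h⟩
      · simp at h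
      · rw [← List.append_assoc] at h
        have := List.append_inj_right' h rfl
        simp only [List.cons.injEq, and_true] at this
        exact hc (this ▸ hv b (by simp))

/-- Star-free languages are preserved by the inverse of the substitution that maps a letter `t`
to all words `u c` with `τ u = t`. -/
theorem Language.IsStarFree.blockConcat_image [Finite α] (hc : c ∉ B) {T : Type*}
    (τ : {u : List α // ∀ a ∈ u, a ∈ B} → T)
    (hτ : ∀ t, Language.IsStarFree ({w | ∃ u, u.1 = w ∧ τ u = t} : Set (List α)))
    {K : Language T} (hK : K.IsStarFree) :
    Language.IsStarFree ({w | ∃ us, us.map τ ∈ K ∧ blockConcat c us = w} : Set (List α)) := by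
  have hinj := blockConcat_injective hc
  induction hK with
  | empty => exact empty.congr fun w => ⟨fun ⟨_, h, _⟩ => h.elim, fun h => h.elim⟩
  | epsilon =>
    refine epsilon.congr fun w => ⟨?_, ?_⟩
    · rintro ⟨us, h, rfl⟩
      rw [Language.mem_one, List.map_eq_nil_iff] at h
      subst h
      rfl
    · intro h
      rw [Language.mem_one] at h
      subst h
      exact ⟨[], rfl, rfl⟩
  | letter t =>
    refine ((hτ t).product (letter c)).congr fun w => ⟨?_, ?_⟩
    · rintro ⟨us, h, rfl⟩
      obtain ⟨u, rfl, rfl⟩ := List.map_eq_singleton_iff.1 h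
      exact Language.append_mem_mul (b := [c]) ⟨u, rfl, rfl⟩ rfl
    · intro h
      obtain ⟨_, ⟨u, rfl, rfl⟩, z, hz, rfl⟩ := Language.mem_mul.1 h
      obtain rfl : z = [c] := hz
      exact ⟨[u], rfl, rfl⟩
  | compl _ ih =>
    -- By injectivity, the image of a complement is the range of `blockConcat` minus the image. The
    -- range is itself star-free by `mem_range_blockConcat`.
    refine (((forall_mem (insert c B)).inter
      (epsilon.union (univ.product (letter c)))).inter ih.compl).congr fun w => ?_
    have hr := mem_range_blockConcat hc w
    have he : w ∈ ((1 : Language α) + (⊤ : Language α) * ({[c]} : Language α)) ↔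
        (w = [] ∨ ∃ x, w = x ++ [c]) := by
      rw [Language.mem_add, Language.mem_one, Language.mem_mul]
      refine or_congr Iff.rfl ⟨?_, ?_⟩
      · rintro ⟨x, -, z, hz, rfl⟩
        have hz : z = [c] := hz
        exact ⟨x, by rw [hz]⟩
      · rintro ⟨x, rfl⟩
        exact ⟨x, Set.mem_univ x, [c], rfl, rfl⟩
    constructor
    · rintro ⟨us, h, rfl⟩
      obtain ⟨h1, h2⟩ := hr.1 ⟨us, rfl⟩
      refine ⟨⟨h1, he.2 h2⟩, ?_⟩
      rintro ⟨vs, h3, h4⟩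
      exact h (hinj h4 ▸ h3)
    · rintro ⟨⟨h1, h2⟩, h3⟩
      obtain ⟨us, rfl⟩ := hr.2 ⟨h1, he.1 h2⟩
      exact ⟨us, fun h => h3 ⟨us, h, rfl⟩, rfl⟩
  | union _ _ ih₁ ih₂ =>
    refine (ih₁.union ih₂).congr fun w => ⟨?_, ?_⟩
    · rintro ⟨us, h | h, rfl⟩
      exacts [Or.inl ⟨us, h, rfl⟩, Or.inr ⟨us, h, rfl⟩]
    · rintro (⟨us, h, rfl⟩ | ⟨us, h, rfl⟩)
      exacts [⟨us, Or.inl h, rfl⟩, ⟨us, Or.inr h, rfl⟩]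
  | inter _ _ ih₁ ih₂ =>
    refine (ih₁.inter ih₂).congr fun w => ⟨?_, ?_⟩
    · rintro ⟨us, ⟨h₁, h₂⟩, rfl⟩
      exact ⟨⟨us, h₁, rfl⟩, ⟨us, h₂, rfl⟩⟩
    · rintro ⟨⟨us, h₁, rfl⟩, ⟨vs, h₂, h⟩⟩
      exact ⟨us, ⟨h₁, hinj h ▸ h₂⟩, rfl⟩
  | product _ _ ih₁ ih₂ =>
    refine (ih₁.product ih₂).congr fun w => ⟨?_, ?_⟩
    · rintro ⟨us, h, rfl⟩
      obtain ⟨x, hx, y, hy, hxy⟩ := Language.mem_mul.1 h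
      obtain ⟨us, vs, rfl, rfl, rfl⟩ := List.map_eq_append_iff.1 hxy.symm
      rw [blockConcat_append]
      exact Language.append_mem_mul ⟨us, hx, rfl⟩ ⟨vs, hy, rfl⟩
    · intro h
      obtain ⟨_, ⟨us, hu, rfl⟩, _, ⟨vs, hv, rfl⟩, rfl⟩ := Language.mem_mul.1 h
      exact ⟨us ++ vs, by rw [List.map_append]; exact Language.append_mem_mul hu hv,
        blockConcat_append us vs⟩

end blockConcat

/-! ### Counter-free automata accept star-free languages -/

/-- An automaton is counter-free if no word permutes a set of states non-trivially. -/
def DFA.IsCounterFree {α σ : Type*} (M : DFA α σ) : Prop :=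
  ∀ (w : List α) (n : ℕ) (p : σ), 0 < n → (M.transformation w)^[n] p = p → M.evalFrom p w = p

/-- The automaton on the image of the letter `c` whose letters are the transformations performed by
words over `B`, each followed by `c`. -/
def DFA.blockDFA {α σ : Type*} (M : DFA α σ) (B : Set α) (c : α) (p : σ) :
    DFA {f : σ → σ // ∃ u : List α, (∀ a ∈ u, a ∈ B) ∧ M.transformation u = f}
      (Set.range fun q => M.step q c) where
  step q f := ⟨M.step (f.1 q.1) c, f.1 q.1, rfl⟩
  -- Only the transitions matter below; `p` merely supplies some element of the image of `c`.
  start := ⟨M.step p c, p, rfl⟩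
  accept := ∅

namespace DFA

variable {α σ : Type*} (M : DFA α σ) (B : Set α) (c : α)

/-- The letter of the block automaton given by a word over `B`. -/
def blockLetter (u : {u : List α // ∀ a ∈ u, a ∈ B}) :
    {f : σ → σ // ∃ u : List α, (∀ a ∈ u, a ∈ B) ∧ M.transformation u = f} :=
  ⟨M.transformation u.1, u.1, u.2, rfl⟩

theorem blockLetter_surjective : Function.Surjective (M.blockLetter B) := by
  rintro ⟨_, u, hu, rfl⟩
  exact ⟨⟨u, hu⟩, rfl⟩

theorem evalFrom_blockDFA (p : σ) (us : List {u : List α // ∀ a ∈ u, a ∈ B})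
    (q : Set.range fun q => M.step q c) :
    ((M.blockDFA B c p).evalFrom q (us.map (M.blockLetter B))).1 =
      M.evalFrom q.1 (blockConcat c us) := by
  induction us generalizing q with
  | nil => rfl
  | cons u us ih =>
    rw [List.map_cons, DFA.evalFrom_cons, ih, blockConcat, DFA.evalFrom_of_append,
      DFA.evalFrom_cons]
    rfl

variable {M} in
-- A word of blocks acts on the image of `c` as the restriction of the action of its concatenation
-- in `M`, so a counter here would be a counter of `M`.
theorem IsCounterFree.blockDFA (hM : M.IsCounterFree) (p : σ) :
    (M.blockDFA B c p).IsCounterFree := by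
  intro ts n q hn h
  obtain ⟨us, rfl⟩ := (M.blockLetter_surjective B).list_map ts
  apply Subtype.ext
  rw [evalFrom_blockDFA]
  apply hM _ n _ hn
  have hs : Function.Semiconj Subtype.val
      ((M.blockDFA B c p).transformation (us.map (M.blockLetter B)))
      (M.transformation (blockConcat c us)) := fun q => M.evalFrom_blockDFA B c p us q
  rw [← (hs.iterate_right n).eq, h]

variable {M} in
-- A permutation of a finite set has finite order, so every state is periodic under the letter and
-- hence fixed.
theorem IsCounterFree.eq_self_of_surjective [Finite σ] (hM : M.IsCounterFree) {a : α}
    (h : Function.Surjective fun q => M.step q a) (q : σ) : M.step q a = q := by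
  have hb : Function.Bijective fun q => M.step q a := ⟨Finite.injective_iff_surjective.2 h, h⟩
  let e : Equiv.Perm σ := Equiv.ofBijective _ hb
  refine hM [a] (orderOf e) q (orderOf_pos e) ?_
  have : (M.transformation [a]) = e := rfl
  rw [this, ← Equiv.Perm.coe_pow, pow_orderOf_eq_one]
  rfl

end DFA

/-- Lexicographic induction on the number of states, then on the size of `B`. The state bound comes
first, and the alphabet is quantified after it, because the block automaton has fewer states but
possibly many more letters. Its alphabet consists of transformations rather than words, so it stays
finite. -/
theorem DFA.IsCounterFree.isStarFree_aux (n : ℕ) : ∀ {α σ : Type} [Finite α] [Finite σ]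
    (M : DFA α σ), M.IsCounterFree → Nat.card σ ≤ n → ∀ (m : ℕ) (B : Set α), B.ncard ≤ m →
    ∀ p q : σ, Language.IsStarFree
      ({w | (∀ a ∈ w, a ∈ B) ∧ M.evalFrom p w = q} : Set (List α)) := by
  induction n using Nat.strong_induction_on with
  | _ n ihn =>
  intro α σ _ _ M hM hn m
  induction m using Nat.strong_induction_on with
  | _ m ihm =>
  intro B hm p q
  by_cases hid : ∀ a ∈ B, ∀ s, M.step s a = s
  · have hw : ∀ w : List α, (∀ a ∈ w, a ∈ B) → M.evalFrom p w = p := by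
      intro w
      induction w with
      | nil => intro _; rfl
      | cons a w ih =>
        intro h
        rw [DFA.evalFrom_cons, hid a (h a List.mem_cons_self)]
        exact ih fun b hb => h b (List.mem_cons_of_mem a hb)
    by_cases hpq : p = q
    · exact (Language.IsStarFree.forall_mem B).congr fun w =>
        ⟨fun h => h.1, fun h => ⟨h, (hw w h).trans hpq⟩⟩
    · exact Language.IsStarFree.empty.congr fun w =>
        ⟨fun h => hpq ((hw w h.1).symm.trans h.2), fun h => h.elim⟩
  push Not at hid
  obtain ⟨c, hcB, s₀, hs₀⟩ := hid
  have hns : ¬ Function.Surjective fun q => M.step q c := fun h =>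
    hs₀ (hM.eq_self_of_surjective h s₀)
  have hcard : Nat.card (Set.range fun q => M.step q c) < Nat.card σ := by
    have h1 : (Set.range fun q => M.step q c) ≠ Set.univ := fun h => hns (Set.range_eq_univ.1 h)
    have h2 := Set.ncard_lt_ncard (Set.ssubset_univ_iff.2 h1) Set.finite_univ
    rwa [Set.ncard_univ] at h2
  have hlt : (B \ {c}).ncard < m :=
    (Set.ncard_sdiff_singleton_lt_of_mem hcB (Set.toFinite B)).trans_le hm
  have hc : c ∉ B \ {c} := fun h => h.2 rfl
  have hB : insert c (B \ {c}) = B := by simp [hcB]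
  have ihB := ihm _ hlt (B \ {c}) le_rfl
  have ihblock : ∀ (r s : Set.range fun q => M.step q c), Language.IsStarFree
      ({w | ∃ us : List {u : List α // ∀ a ∈ u, a ∈ B \ {c}},
        M.evalFrom r.1 (blockConcat c us) = s.1 ∧ blockConcat c us = w} : Set (List α)) := by
    intro r s
    have h := ihn (Nat.card (Set.range fun q => M.step q c)) (hcard.trans_le hn)
      (M.blockDFA (B \ {c}) c p) (hM.blockDFA _ c p) le_rfl _ Set.univ le_rfl r s
    refine (h.blockConcat_image hc (M.blockLetter (B \ {c})) ?_).congr fun w => ?_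
    · intro t
      have h : ∀ r, Language.IsStarFree
          ({w | (∀ a ∈ w, a ∈ B \ {c}) ∧ M.evalFrom r w = t.1 r} : Set (List α))ᶜ :=
        fun r => (ihB r (t.1 r)).compl
      -- Inducing the transformation `t` is a conjunction of one condition per state, written as the
      -- complement of a finite union.
      refine ((Language.IsStarFree.forall_mem (B \ {c})).inter
        (Language.IsStarFree.finite_exists h).compl).congr fun w => ⟨?_, ?_⟩
      · rintro ⟨u, rfl, rfl⟩
        exact ⟨u.2, fun ⟨r, hr⟩ => hr ⟨u.2, rfl⟩⟩
      · rintro ⟨hw, hw'⟩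
        refine ⟨⟨w, hw⟩, rfl, Subtype.ext (funext fun r => ?_)⟩
        by_contra hr
        exact hw' ⟨r, fun h => hr h.2⟩
    · refine exists_congr fun us => and_congr_left fun _ => ?_
      rw [← M.evalFrom_blockDFA (B \ {c}) c p us r]
      exact ⟨fun h => ⟨fun _ _ => trivial, Subtype.ext h⟩, fun h => congrArg Subtype.val h.2⟩
  -- A word containing `c` factors as `u`, the first `c`, complete blocks, and a remainder; `x`
  -- records the states just before the first `c` and just after the last one.
  have hsum : ∀ x : σ × (Set.range fun q => M.step q c), Language.IsStarFree
      (_ * (_ * (_ * _)) : Language α) := fun x =>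
    (ihB p x.1).product ((Language.IsStarFree.letter c).product
      ((ihblock ⟨M.step x.1 c, x.1, rfl⟩ x.2).product (ihB x.2.1 q)))
  refine ((ihB p q).union (Language.IsStarFree.finite_exists hsum)).congr fun w => ⟨?_, ?_⟩
  · rintro ⟨hw, rfl⟩
    obtain ⟨us, v, rfl⟩ := exists_eq_blockConcat_append (B := B \ {c}) (c := c) w
      (by rwa [hB])
    rcases us with _ | ⟨u, us⟩
    · exact Or.inl ⟨v.2, rfl⟩
    · right
      let r : Set.range fun q => M.step q c := ⟨M.step (M.evalFrom p u.1) c, _, rfl⟩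
      let s := (M.blockDFA (B \ {c}) c p).evalFrom r (us.map (M.blockLetter (B \ {c})))
      have hs : M.evalFrom r.1 (blockConcat c us) = s.1 :=
        (M.evalFrom_blockDFA (B \ {c}) c p us r).symm
      refine ⟨(M.evalFrom p u.1, s), ?_⟩
      have e : blockConcat c (u :: us) ++ v.1 = u.1 ++ ([c] ++ (blockConcat c us ++ v.1)) := by
        simp [blockConcat]
      rw [e]
      refine Language.append_mem_mul ⟨u.2, rfl⟩ (Language.append_mem_mul rfl
        (Language.append_mem_mul ⟨us, hs, rfl⟩ ⟨v.2, ?_⟩))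
      simp only [DFA.evalFrom_of_append, DFA.evalFrom_singleton]
      rw [← hs]
  · have hsub : ∀ {w : List α}, (∀ a ∈ w, a ∈ B \ {c}) → ∀ a ∈ w, a ∈ B :=
      fun h a ha => (h a ha).1
    rintro (⟨hw, rfl⟩ | ⟨⟨r, s⟩, hw⟩)
    · exact ⟨hsub hw, rfl⟩
    · obtain ⟨u, ⟨hu, hu'⟩, y, hy, rfl⟩ := Language.mem_mul.1 hw
      obtain ⟨z, hz, x, hx, rfl⟩ := Language.mem_mul.1 hy
      obtain ⟨_, ⟨us, hus, rfl⟩, v, ⟨hv, hv'⟩, rfl⟩ := Language.mem_mul.1 hx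
      obtain rfl : z = [c] := hz
      refine ⟨fun a ha => ?_, ?_⟩
      · simp only [List.mem_append, List.mem_singleton] at ha
        rcases ha with ha | rfl | ha | ha
        exacts [hsub hu a ha, hcB, hB ▸ mem_of_mem_blockConcat us a ha, hsub hv a ha]
      · simp only [DFA.evalFrom_of_append, DFA.evalFrom_singleton]
        rw [hu', hus, hv']

/-- A finite counter-free automaton accepts a star-free language. -/
theorem DFA.IsCounterFree.isStarFree_accepts {α σ : Type} [Finite α] [Finite σ] {M : DFA α σ}
    (hM : M.IsCounterFree) : M.accepts.IsStarFree := by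
  have h : ∀ q : M.accept, Language.IsStarFree
      ({w | (∀ a ∈ w, a ∈ Set.univ) ∧ M.evalFrom M.start w = q.1} : Set (List α)) := fun q =>
    DFA.IsCounterFree.isStarFree_aux _ M hM le_rfl _ Set.univ le_rfl M.start q.1
  refine (Language.IsStarFree.finite_exists h).congr fun w => ⟨?_, ?_⟩
  · intro hw
    exact ⟨⟨_, hw⟩, fun _ _ => trivial, rfl⟩
  · rintro ⟨q, -, hq⟩
    rw [DFA.mem_accepts, DFA.eval, hq]
    exact q.2

/-! ### Monotonicity notions and maps of automata -/

namespace DFA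

variable {α β σ τ : Type*} {M : DFA α σ} {N : DFA β τ}

theorem evalFrom_map {f : β → α} {g : τ → σ} (hstep : ∀ q b, g (N.step q b) = M.step (g q) (f b))
    (q : τ) (w : List β) : g (N.evalFrom q w) = M.evalFrom (g q) (w.map f) := by
  induction w generalizing q with
  | nil => rfl
  | cons b w ih => rw [evalFrom_cons, ih, hstep, List.map_cons, evalFrom_cons]

theorem evalFrom_removeConstantInputs (q : σ) (w : List {a // ¬ M.IsConstantInput a}) :
    M.removeConstantInputs.evalFrom q w = M.evalFrom q (w.map Subtype.val) :=
  evalFrom_map (M := M) (N := M.removeConstantInputs) (f := Subtype.val) (g := id)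
    (fun _ _ => rfl) q w

theorem isEmptyState_iff {q : σ} : M.IsEmptyState q ↔ ∀ w, M.evalFrom q w ∉ M.accept :=
  ⟨fun h w hw => Language.notMem_zero w (h ▸ hw),
    fun h => Language.ext fun w => ⟨fun hw => (h w hw).elim, fun hw => hw.elim⟩⟩

theorem IsEmptyState.evalFrom {q : σ} (h : M.IsEmptyState q) (w : List α) :
    M.IsEmptyState (M.evalFrom q w) := by
  rw [isEmptyState_iff] at h ⊢
  intro x
  rw [← evalFrom_of_append]
  exact h _

/-- Runs of `N` accepting a word map to accepting runs of `M`. The converse can fail, as `f` need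
not reach all letters. -/
theorem IsEmptyState.of_map {f : β → α} {g : τ → σ}
    (hstep : ∀ q b, g (N.step q b) = M.step (g q) (f b))
    (hacc : ∀ q ∈ N.accept, g q ∈ M.accept) {q : τ} (h : M.IsEmptyState (g q)) :
    N.IsEmptyState q := by
  rw [isEmptyState_iff] at h ⊢
  intro w hw
  have := hacc _ hw
  rw [evalFrom_map hstep] at this
  exact h _ this

theorem transformation_removeEmpty_eq_some (w : List α) (q q' : {q : σ // ¬ M.IsEmptyState q}) :
    M.removeEmpty.transformation w q = some q' ↔ M.evalFrom q.1 w = q'.1 := by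
  induction w generalizing q with
  | nil => simp [IDFA.transformation, Subtype.ext_iff]
  | cons a w ih =>
    by_cases h : M.IsEmptyState (M.step q.1 a)
    · have h1 : M.removeEmpty.step q a = none := dif_neg (not_not.2 h)
      simp only [IDFA.transformation, h1, Option.bind_none, evalFrom_cons, reduceCtorEq, false_iff]
      intro h2
      exact q'.2 (h2 ▸ h.evalFrom w)
    · have h1 : M.removeEmpty.step q a = some ⟨M.step q.1 a, h⟩ := dif_pos h
      simp only [IDFA.transformation, h1, Option.bind_some, evalFrom_cons, ih]

theorem isPartiallyMonotonic_iff : M.IsPartiallyMonotonic ↔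
    ∃ _ : LinearOrder {q : σ // ¬ M.IsEmptyState q}, ∀ (w : List α)
      (p q p' q' : {q : σ // ¬ M.IsEmptyState q}),
      M.evalFrom p.1 w = p'.1 → M.evalFrom q.1 w = q'.1 → p ≤ q → p' ≤ q' := by
  refine exists_congr fun i => ⟨fun h w p q p' q' hp hq hpq => ?_, ?_⟩
  · rcases eq_or_ne w [] with rfl | hw
    · rwa [← Subtype.ext (a1 := p) hp, ← Subtype.ext (a1 := q) hq]
    · exact h _ ⟨w, hw, rfl⟩ p q p' q' ((transformation_removeEmpty_eq_some w p p').2 hp)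
        ((transformation_removeEmpty_eq_some w q q').2 hq) hpq
  · rintro h _ ⟨w, -, rfl⟩ p q p' q' hp hq hpq
    exact h w p q p' q' ((transformation_removeEmpty_eq_some w p p').1 hp)
      ((transformation_removeEmpty_eq_some w q q').1 hq) hpq

theorem IsMonotonic.isPartiallyMonotonic (h : M.IsMonotonic) : M.IsPartiallyMonotonic := by
  obtain ⟨i, hi⟩ := h
  refine ⟨inferInstance, ?_⟩
  rintro _ ⟨w, hw, rfl⟩ p q p' q' hp hq hpq
  rw [transformation_removeEmpty_eq_some] at hp hq
  have := hi _ ⟨w, hw, rfl⟩ p.1 q.1 hpq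
  change M.evalFrom p.1 w ≤ M.evalFrom q.1 w at this
  rw [hp, hq] at this
  exact this

theorem IsPartiallyMonotonic.isMonotonic (h : M.IsPartiallyMonotonic)
    (hM : ∀ q, ¬ M.IsEmptyState q) : M.IsMonotonic := by
  obtain ⟨i, hi⟩ := isPartiallyMonotonic_iff.1 h
  refine ⟨LinearOrder.lift' (fun q => (⟨q, hM q⟩ : {q : σ // ¬ M.IsEmptyState q}))
    fun p q h => congrArg Subtype.val h, ?_⟩
  rintro _ ⟨w, -, rfl⟩ p q hpq
  exact hi w ⟨p, hM p⟩ ⟨q, hM q⟩ _ _ rfl rfl hpq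

/-- Empty states are absorbing, so a run ending in a non-empty state avoids them throughout and
letters can be treated one at a time. -/
theorem IsPartiallyMonotonic.of_step [LinearOrder σ]
    (h : ∀ a p q, ¬ M.IsEmptyState (M.step p a) → ¬ M.IsEmptyState (M.step q a) → p ≤ q →
      M.step p a ≤ M.step q a) : M.IsPartiallyMonotonic := by
  refine isPartiallyMonotonic_iff.2 ⟨inferInstance, ?_⟩
  rintro w ⟨p, hp⟩ ⟨q, hq⟩ p' q' hp' hq' hpq
  change p ≤ q at hpq
  change p'.1 ≤ q'.1
  induction w generalizing p q with
  | nil => rwa [← hp', ← hq']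
  | cons a w ih =>
    have hp1 : ¬ M.IsEmptyState (M.step p a) := fun h => p'.2 (hp' ▸ h.evalFrom w)
    have hq1 : ¬ M.IsEmptyState (M.step q a) := fun h => q'.2 (hq' ▸ h.evalFrom w)
    exact ih _ hp1 _ hq1 hp' hq' (h a p q hp1 hq1 hpq)

/-- The order is unbundled to avoid confusion with the standard order on `Fin 3` in the examples. -/
theorem IsMonotonic.exists_total_order (h : M.IsMonotonic) :
    ∃ r : σ → σ → Prop, (∀ p q, r p q ∨ r q p) ∧ (∀ p q s, r p q → r q s → r p s) ∧
      (∀ p q, r p q → r q p → p = q) ∧ ∀ a p q, r p q → r (M.step p a) (M.step q a) := by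
  obtain ⟨i, hi⟩ := h
  exact ⟨i.le, le_total, fun _ _ _ => le_trans, fun _ _ => le_antisymm,
    fun a => hi _ ⟨[a], List.cons_ne_nil a [], rfl⟩⟩

section map

variable {f : β → α} {g : τ → σ}

theorem IsMonotonic.of_map (h : M.IsMonotonic) (hg : Function.Injective g)
    (hstep : ∀ q b, g (N.step q b) = M.step (g q) (f b)) : N.IsMonotonic := by
  obtain ⟨i, hi⟩ := h
  refine ⟨LinearOrder.lift' g hg, ?_⟩
  rintro _ ⟨w, hw, rfl⟩ p q hpq
  change g (N.evalFrom p w) ≤ g (N.evalFrom q w)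
  rw [evalFrom_map hstep, evalFrom_map hstep]
  exact hi _ ⟨w.map f, by simpa using hw, rfl⟩ _ _ hpq

theorem IsPartiallyMonotonic.of_map (h : M.IsPartiallyMonotonic) (hg : Function.Injective g)
    (hstep : ∀ q b, g (N.step q b) = M.step (g q) (f b))
    (hacc : ∀ q ∈ N.accept, g q ∈ M.accept) : N.IsPartiallyMonotonic := by
  rw [isPartiallyMonotonic_iff] at h ⊢
  obtain ⟨i, hi⟩ := h
  let G : {q : τ // ¬ N.IsEmptyState q} → {q : σ // ¬ M.IsEmptyState q} :=
    fun q => ⟨g q.1, fun h => q.2 (h.of_map hstep hacc)⟩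
  refine ⟨LinearOrder.lift' G fun p q h => Subtype.ext (hg (congrArg Subtype.val h)), ?_⟩
  intro w p q p' q' hp hq hpq
  refine hi (w.map f) (G p) (G q) (G p') (G q') ?_ ?_ hpq
  · rw [← evalFrom_map hstep, hp]
  · rw [← evalFrom_map hstep, hq]

/-- As `g` is injective, a letter whose image under `f` is constant is itself constant, so `f`
restricts to the non-constant letters. -/
theorem IsNearlyMonotonic.of_map (h : M.IsNearlyMonotonic) (hg : Function.Injective g)
    (hstep : ∀ q b, g (N.step q b) = M.step (g q) (f b))
    (hacc : ∀ q ∈ N.accept, g q ∈ M.accept) : N.IsNearlyMonotonic := by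
  have hf : ∀ b : {b // ¬ N.IsConstantInput b}, ¬ M.IsConstantInput (f b.1) := by
    intro b hb
    refine b.2 fun p q => hg ?_
    rw [hstep, hstep]
    exact hb _ _
  exact IsPartiallyMonotonic.of_map (M := M.removeConstantInputs) (N := N.removeConstantInputs)
    (f := fun b => ⟨f b.1, hf b⟩) h hg (fun q b => hstep q b.1) hacc

end map

theorem IsPartiallyMonotonic.isNearlyMonotonic (h : M.IsPartiallyMonotonic) :
    M.IsNearlyMonotonic :=
  h.of_map (f := Subtype.val) (g := id) Function.injective_id (fun _ _ => rfl) fun _ => id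

/-! ### Nearly monotonic minimal automata are counter-free -/

theorem evalFrom_eq_of_isConstantInput {w : List α} (hw : ∃ a ∈ w, M.IsConstantInput a) (p q : σ) :
    M.evalFrom p w = M.evalFrom q w := by
  obtain ⟨a, haw, ha⟩ := hw
  obtain ⟨x, y, rfl⟩ := List.append_of_mem haw
  rw [evalFrom_of_append, evalFrom_of_append, evalFrom_cons, evalFrom_cons, ha]

theorem exists_eq_map_val {w : List α} (hw : ¬ ∃ a ∈ w, M.IsConstantInput a) :
    ∃ x : List {a // ¬ M.IsConstantInput a}, w = x.map Subtype.val := by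
  push Not at hw
  lift w to List {a // ¬ M.IsConstantInput a} using hw
  exact ⟨w, rfl⟩

/-- Words with a constant letter act alike on `p` and `q`, and all other words are rejected from
both; thus `p` and `q` accept the same language. -/
theorem eq_of_isEmptyState_removeConstantInputs (hM : Function.Injective M.acceptsFrom) {p q : σ}
    (hp : M.removeConstantInputs.IsEmptyState p) (hq : M.removeConstantInputs.IsEmptyState q) :
    p = q := by
  rw [isEmptyState_iff] at hp hq
  refine hM (Language.ext fun w => ?_)
  rw [mem_acceptsFrom, mem_acceptsFrom]
  by_cases hw : ∃ a ∈ w, M.IsConstantInput a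
  · rw [evalFrom_eq_of_isConstantInput hw p q]
  · obtain ⟨x, rfl⟩ := exists_eq_map_val hw
    rw [← evalFrom_removeConstantInputs, ← evalFrom_removeConstantInputs]
    exact iff_of_false (hp x) (hq x)

theorem IsNearlyMonotonic.isCounterFree (h : M.IsNearlyMonotonic)
    (hM : Function.Injective M.acceptsFrom) : M.IsCounterFree := by
  intro w n p hn hp
  by_cases hw : ∃ a ∈ w, M.IsConstantInput a
  · obtain ⟨k, rfl⟩ := Nat.exists_eq_succ_of_ne_zero hn.ne'
    rw [Function.iterate_succ_apply'] at hp
    exact (evalFrom_eq_of_isConstantInput hw _ _).trans hp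
  obtain ⟨x, rfl⟩ := exists_eq_map_val hw
  have ht : M.transformation (x.map Subtype.val) =
      fun q => M.removeConstantInputs.evalFrom q x :=
    funext fun q => (evalFrom_removeConstantInputs q x).symm
  rw [ht] at hp
  rw [← evalFrom_removeConstantInputs]
  by_cases he : M.removeConstantInputs.IsEmptyState p
  · exact eq_of_isEmptyState_removeConstantInputs hM (he.evalFrom x) he
  set f : σ → σ := fun q => M.removeConstantInputs.evalFrom q x with hf
  have hstep : ∀ i j, M.removeConstantInputs.IsEmptyState (f^[i] p) →
      M.removeConstantInputs.IsEmptyState (f^[j + i] p) := by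
    intro i j hi
    induction j with
    | zero => rwa [Nat.zero_add]
    | succ j ih =>
      rw [Nat.succ_add, Function.iterate_succ_apply']
      exact ih.evalFrom x
  have hne : ∀ i, ¬ M.removeConstantInputs.IsEmptyState (f^[i] p) := by
    intro i hi
    have h1 : f^[n * i] p = p := Function.IsPeriodicPt.const_mul hp i |> fun h => by
      rw [Nat.mul_comm]; exact h
    -- Since `n * i` is a multiple of the period and at least `i`, emptiness of the `i`-th iterate
    -- would propagate back to `p`.
    have h2 := hstep i (n * i - i) hi
    rw [Nat.sub_add_cancel (Nat.le_mul_of_pos_left i hn), h1] at h2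
    exact he h2
  obtain ⟨_, ho⟩ := isPartiallyMonotonic_iff.1 h
  let s : ℕ → {q : σ // ¬ M.removeConstantInputs.IsEmptyState q} := fun i => ⟨f^[i] p, hne i⟩
  have hs : ∀ i j, s i ≤ s j → s (i + 1) ≤ s (j + 1) := fun i j =>
    ho x (s i) (s j) (s (i + 1)) (s (j + 1)) (Function.iterate_succ_apply' f i p).symm
      (Function.iterate_succ_apply' f j p).symm
  have hsn : s n = s 0 := Subtype.ext hp
  -- The comparison of `s 0` with `s 1` propagates along the orbit, so `s 1` is squeezed between `s
  -- 0` and `s n = s 0`.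
  have h01 : s 1 = s 0 := by
    rcases le_total (s 0) (s 1) with h | h
    · have hmono : Monotone s := monotone_nat_of_le_succ fun i => by
        induction i with
        | zero => exact h
        | succ i ih => exact hs _ _ ih
      exact le_antisymm (hsn ▸ hmono hn) h
    · have hanti : Antitone s := antitone_nat_of_succ_le fun i => by
        induction i with
        | zero => exact h
        | succ i ih => exact hs _ _ ih
      exact le_antisymm h (hsn ▸ hanti hn)
  exact congrArg Subtype.val h01

end DFA

/-! ### The quotient automaton -/

namespace Language

theorem evalFrom_toDFA {α : Type*} (L : Language α) (s : Set.range L.leftQuotient) (w : List α) :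
    (L.toDFA.evalFrom s w).1 = s.1.leftQuotient w := by
  induction w generalizing s with
  | nil => rfl
  | cons a w ih => rw [DFA.evalFrom_cons, ih, step_toDFA, ← leftQuotient_append]; rfl

theorem acceptsFrom_toDFA {α : Type*} (L : Language α) (s : Set.range L.leftQuotient) :
    L.toDFA.acceptsFrom s = s.1 := by
  ext w
  rw [DFA.mem_acceptsFrom, mem_accept_toDFA, evalFrom_toDFA, mem_leftQuotient, List.append_nil]

theorem IsNearlyMonotonic.isStarFree {α : Type} [Finite α] {L : Language α}
    (h : L.IsNearlyMonotonic) : L.IsStarFree := by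
  have : Finite (Set.range L.leftQuotient) := h.1.finite_range_leftQuotient
  rw [← L.accepts_toDFA]
  refine (h.2.isCounterFree fun s t hst => Subtype.ext ?_).isStarFree_accepts
  rwa [acceptsFrom_toDFA, acceptsFrom_toDFA] at hst

end Language

/-- The states of a minimal automaton correspond to the left quotients of its language. -/
theorem DFA.exists_equiv_toDFA {α σ : Type*} {M : DFA α σ} (hreach : ∀ q, ∃ w, M.eval w = q)
    (hM : Function.Injective M.acceptsFrom) :
    ∃ e : σ ≃ Set.range M.accepts.leftQuotient,
      (∀ q a, e (M.step q a) = M.accepts.toDFA.step (e q) a) ∧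
      ∀ q, e q ∈ M.accepts.toDFA.accept ↔ q ∈ M.accept := by
  have hmem : ∀ q, M.acceptsFrom q ∈ Set.range M.accepts.leftQuotient := by
    intro q
    obtain ⟨w, rfl⟩ := hreach q
    exact ⟨w, Language.leftQuotient_accepts_apply M w⟩
  let g : σ → Set.range M.accepts.leftQuotient := fun q => ⟨M.acceptsFrom q, hmem q⟩
  have hg : Function.Bijective g := by
    refine ⟨fun p q h => hM (congrArg Subtype.val h), ?_⟩
    rintro ⟨_, w, rfl⟩
    exact ⟨M.eval w, Subtype.ext (Language.leftQuotient_accepts_apply M w).symm⟩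
  refine ⟨Equiv.ofBijective g hg, fun q a => Subtype.ext ?_, fun q => Iff.rfl⟩
  rfl

section minimal

variable {α σ : Type*} {M : DFA α σ}

theorem DFA.isMonotonic_toDFA_iff (hreach : ∀ q, ∃ w, M.eval w = q)
    (hM : Function.Injective M.acceptsFrom) : M.accepts.toDFA.IsMonotonic ↔ M.IsMonotonic := by
  obtain ⟨e, hstep, hacc⟩ := DFA.exists_equiv_toDFA hreach hM
  have hstep' : ∀ q a, e.symm (M.accepts.toDFA.step q a) = M.step (e.symm q) a := fun q a => by
    rw [Equiv.symm_apply_eq, hstep, e.apply_symm_apply]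
  exact ⟨fun h => h.of_map (f := id) e.injective hstep,
    fun h => h.of_map (f := id) e.symm.injective hstep'⟩

theorem DFA.isPartiallyMonotonic_toDFA_iff (hreach : ∀ q, ∃ w, M.eval w = q)
    (hM : Function.Injective M.acceptsFrom) :
    M.accepts.toDFA.IsPartiallyMonotonic ↔ M.IsPartiallyMonotonic := by
  obtain ⟨e, hstep, hacc⟩ := DFA.exists_equiv_toDFA hreach hM
  have hstep' : ∀ q a, e.symm (M.accepts.toDFA.step q a) = M.step (e.symm q) a := fun q a => by
    rw [Equiv.symm_apply_eq, hstep, e.apply_symm_apply]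
  exact ⟨fun h => h.of_map (f := id) e.injective hstep fun q => (hacc q).2,
    fun h => h.of_map (f := id) e.symm.injective hstep' fun q hq =>
      (hacc _).1 (by rwa [e.apply_symm_apply])⟩

theorem DFA.isNearlyMonotonic_toDFA_iff (hreach : ∀ q, ∃ w, M.eval w = q)
    (hM : Function.Injective M.acceptsFrom) :
    M.accepts.toDFA.IsNearlyMonotonic ↔ M.IsNearlyMonotonic := by
  obtain ⟨e, hstep, hacc⟩ := DFA.exists_equiv_toDFA hreach hM
  have hstep' : ∀ q a, e.symm (M.accepts.toDFA.step q a) = M.step (e.symm q) a := fun q a => by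
    rw [Equiv.symm_apply_eq, hstep, e.apply_symm_apply]
  exact ⟨fun h => h.of_map (f := id) e.injective hstep fun q => (hacc q).2,
    fun h => h.of_map (f := id) e.symm.injective hstep' fun q hq =>
      (hacc _).1 (by rwa [e.apply_symm_apply])⟩

end minimal

/-! ### The inclusions -/

theorem classM_subset_classPM : classM ⊆ classPM :=
  fun _ h => ⟨h.1, h.2.1, h.2.2.1, h.2.2.2.isPartiallyMonotonic⟩

theorem classPM_subset_classNM : classPM ⊆ classNM :=
  fun _ h => ⟨h.1, h.2.1, h.2.2.1, DFA.IsPartiallyMonotonic.isNearlyMonotonic h.2.2.2⟩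

theorem classNM_subset_classSF : classNM ⊆ classSF :=
  fun _ h => ⟨h.1, h.2.1, have := h.1; h.2.2.isStarFree⟩

/-! ### The three examples -/

theorem isRegular_accepts {α σ : Type} [Fintype σ] (M : DFA α σ) : M.accepts.IsRegular :=
  ⟨σ, inferInstance, M, rfl⟩

theorem dfaPMnotM_reachable (q : Fin 3) : ∃ w, dfaPMnotM.eval w = q := by
  fin_cases q
  exacts [⟨[], rfl⟩, ⟨[1], rfl⟩, ⟨[0], rfl⟩]

theorem dfaNMnotPM_reachable (q : Fin 3) : ∃ w, dfaNMnotPM.eval w = q := by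
  fin_cases q
  exacts [⟨[], rfl⟩, ⟨[1], rfl⟩, ⟨[0], rfl⟩]

theorem dfaSFnotNM_reachable (q : Fin 3) : ∃ w, dfaSFnotNM.eval w = q := by
  fin_cases q
  exacts [⟨[], rfl⟩, ⟨[1], rfl⟩, ⟨[0], rfl⟩]

/-- The empty word is accepted only from state `0`, and the word `a` only from state `1`. -/
theorem dfaPMnotM_minimal : Function.Injective dfaPMnotM.acceptsFrom := by
  intro p q h
  have h0 : p = 0 ↔ q = 0 := Set.ext_iff.1 h []
  have h1 : dfaPMnotM.step p 0 = 0 ↔ dfaPMnotM.step q 0 = 0 := Set.ext_iff.1 h [0]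
  clear h
  simp only [dfaPMnotM] at h1
  decide +revert

theorem dfaNMnotPM_minimal : Function.Injective dfaNMnotPM.acceptsFrom := by
  intro p q h
  have h0 : p = 0 ↔ q = 0 := Set.ext_iff.1 h []
  have h1 : dfaNMnotPM.step p 0 = 0 ↔ dfaNMnotPM.step q 0 = 0 := Set.ext_iff.1 h [0]
  clear h
  simp only [dfaNMnotPM] at h1
  decide +revert

/-- The empty word is accepted only from state `2`, and the word `a` only from state `0`. -/
theorem dfaSFnotNM_minimal : Function.Injective dfaSFnotNM.acceptsFrom := by
  intro p q h
  have h0 : p = 2 ↔ q = 2 := Set.ext_iff.1 h []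
  have h1 : dfaSFnotNM.step p 0 = 2 ↔ dfaSFnotNM.step q 0 = 2 := Set.ext_iff.1 h [0]
  clear h
  simp only [dfaSFnotNM] at h1
  decide +revert

theorem dfaPMnotM_isEmptyState_two : dfaPMnotM.IsEmptyState 2 := by
  have h : ∀ w, dfaPMnotM.evalFrom 2 w = 2 := by
    intro w
    induction w with
    | nil => rfl
    | cons a w ih =>
      rw [DFA.evalFrom_cons]
      fin_cases a <;> exact ih
  refine DFA.isEmptyState_iff.2 fun w hw => ?_
  rw [h w] at hw
  exact absurd (show (2 : Fin 3) = 0 from hw) (by decide)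

/-- Without the empty state `2`, the letters `a` and `b` are defined at one state each and `c` is
constant, so nothing can be reversed. -/
theorem dfaPMnotM_isPartiallyMonotonic : dfaPMnotM.IsPartiallyMonotonic := by
  refine DFA.IsPartiallyMonotonic.of_step fun a p q hp hq => ?_
  have hp' : dfaPMnotM.step p a ≠ 2 := fun h => hp (h ▸ dfaPMnotM_isEmptyState_two)
  have hq' : dfaPMnotM.step q a ≠ 2 := fun h => hq (h ▸ dfaPMnotM_isEmptyState_two)
  clear hp hq
  simp only [dfaPMnotM] at hp' hq' ⊢
  decide +revert

theorem dfaPMnotM_not_isMonotonic : ¬ dfaPMnotM.IsMonotonic := by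
  intro h
  obtain ⟨r, htotal, htrans, hanti, h⟩ := h.exists_total_order
  have h01 : (0 : Fin 3) ≠ 1 := by decide
  -- If `0 ≤ 1`, then `a` gives `2 ≤ 0` and `b` gives `1 ≤ 2`, whence `1 ≤ 0`; the other case is
  -- dual.
  rcases htotal 0 1 with h1 | h1
  · have h2 : r 2 0 := h 0 _ _ h1
    have h3 : r 1 2 := h 1 _ _ h1
    exact h01 (hanti _ _ h1 (htrans _ _ _ h3 h2))
  · have h2 : r 0 2 := h 0 _ _ h1
    have h3 : r 2 1 := h 1 _ _ h1
    exact h01 (hanti _ _ (htrans _ _ _ h2 h3) h1)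

theorem dfaNMnotPM_not_isConstantInput (a : {a // ¬ dfaNMnotPM.IsConstantInput a}) : a.1 < 3 := by
  refine lt_of_le_of_ne (Fin.le_last a.1) fun h => a.2 ?_
  rw [h]
  intro p q
  fin_cases p <;> fin_cases q <;> rfl

theorem dfaNMnotPM_isNearlyMonotonic : dfaNMnotPM.IsNearlyMonotonic := by
  refine DFA.IsPartiallyMonotonic.of_map (g := id)
    (f := fun a => ⟨a.1.1, dfaNMnotPM_not_isConstantInput a⟩) dfaPMnotM_isPartiallyMonotonic
    Function.injective_id ?_ fun _ => id
  rintro q ⟨a, ha⟩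
  have h := dfaNMnotPM_not_isConstantInput ⟨a, ha⟩
  fin_cases a
  · rfl
  · rfl
  · rfl
  · exact absurd (show (3 : Fin 4) < 3 from h) (by decide)

/-- The letter `d` sends every state to the final state, so no state is empty and partial
monotonicity would be full monotonicity, which restricts to the letters `a`, `b`, `c`. -/
theorem dfaNMnotPM_not_isPartiallyMonotonic : ¬ dfaNMnotPM.IsPartiallyMonotonic := by
  intro h
  refine dfaPMnotM_not_isMonotonic ((h.isMonotonic fun q hq => ?_).of_map (f := Fin.castSucc)
    (g := id) Function.injective_id fun q a => ?_)
  · exact DFA.isEmptyState_iff.1 hq [3] (by fin_cases q <;> rfl)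
  · fin_cases a <;> rfl

theorem dfaSFnotNM_not_isNearlyMonotonic : ¬ dfaSFnotNM.IsNearlyMonotonic := by
  intro h
  have ha : ¬ dfaSFnotNM.IsConstantInput 0 := fun h =>
    absurd (show (2 : Fin 3) = 1 from h 0 1) (by decide)
  have hb : ¬ dfaSFnotNM.IsConstantInput 1 := fun h =>
    absurd (show (1 : Fin 3) = 2 from h 0 1) (by decide)
  -- Neither letter is constant, and `bb` is accepted from every state, so nothing is removed. The
  -- letters then send the pair `0, 1` to `2, 1` and to `1, 2`, in opposite orders.
  obtain ⟨r, htotal, -, hanti, h⟩ := (DFA.IsPartiallyMonotonic.isMonotonic h fun q hq =>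
    DFA.isEmptyState_iff.1 hq [⟨1, hb⟩, ⟨1, hb⟩] (by fin_cases q <;> rfl)).exists_total_order
  have h12 : (1 : Fin 3) ≠ 2 := by decide
  rcases htotal 0 1 with h1 | h1
  · have h2 : r 2 1 := h ⟨0, ha⟩ _ _ h1
    have h3 : r 1 2 := h ⟨1, hb⟩ _ _ h1
    exact h12 (hanti _ _ h3 h2)
  · have h2 : r 1 2 := h ⟨0, ha⟩ _ _ h1
    have h3 : r 2 1 := h ⟨1, hb⟩ _ _ h1
    exact h12 (hanti _ _ h2 h3)

/-- No transition enters state `0`. From the other two states `a` leads to `1` and `b` to `2`, so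
beyond length one the last letter decides acceptance. -/
theorem dfaSFnotNM_eval_ne_zero (x : List (Fin 2)) (a : Fin 2) :
    dfaSFnotNM.eval (x ++ [a]) ≠ 0 := by
  rw [DFA.eval_append_singleton]
  generalize dfaSFnotNM.eval x = q
  simp only [dfaSFnotNM]
  decide +revert

/-- The accepted language is `{a} ∪ Σ⁺ b`. -/
theorem dfaSFnotNM_isStarFree : dfaSFnotNM.accepts.IsStarFree := by
  refine ((Language.IsStarFree.letter 0).union
    (Language.IsStarFree.epsilon.compl.product (Language.IsStarFree.letter 1))).congr fun w => ?_
  refine Iff.trans ?_ (Language.mem_add _ _ _).symm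
  constructor
  · intro h
    change dfaSFnotNM.eval w = 2 at h
    rcases List.eq_nil_or_concat' w with rfl | ⟨x, a, rfl⟩
    · exact absurd (show (0 : Fin 3) = 2 from h) (by decide)
    rw [DFA.eval_append_singleton] at h
    rcases List.eq_nil_or_concat' x with rfl | ⟨x, b, rfl⟩
    · left
      fin_cases a
      · rfl
      · exact absurd (show (1 : Fin 3) = 2 from h) (by decide)
    · right
      refine ⟨x ++ [b], ?_, [1], rfl, ?_⟩
      · intro h
        exact absurd (show x ++ [b] = [] from h) (by simp)
      · have hne := dfaSFnotNM_eval_ne_zero x b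
        revert hne h
        generalize dfaSFnotNM.eval (x ++ [b]) = q
        intro h hne
        have : a = 1 := by
          simp only [dfaSFnotNM] at h
          decide +revert
        rw [this]
  · change _ → dfaSFnotNM.eval w = 2
    rintro (h | ⟨x, hx, y, hy, rfl⟩)
    · obtain rfl : w = [0] := h
      rfl
    · obtain rfl : y = [1] := hy
      rcases List.eq_nil_or_concat' x with rfl | ⟨x, b, rfl⟩
      · exact (hx rfl).elim
      · rw [DFA.eval_append_singleton]
        have hne := dfaSFnotNM_eval_ne_zero x b
        revert hne
        generalize dfaSFnotNM.eval (x ++ [b]) = q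
        simp only [dfaSFnotNM]
        decide +revert

theorem dfaPMnotM_mem : (⟨Fin 3, dfaPMnotM.accepts⟩ : (α : Type) × Language α) ∈
    classPM \ classM :=
  ⟨⟨inferInstance, inferInstance, isRegular_accepts _,
    (DFA.isPartiallyMonotonic_toDFA_iff dfaPMnotM_reachable dfaPMnotM_minimal).2
      dfaPMnotM_isPartiallyMonotonic⟩,
    fun h => dfaPMnotM_not_isMonotonic
      ((DFA.isMonotonic_toDFA_iff dfaPMnotM_reachable dfaPMnotM_minimal).1 h.2.2.2)⟩

theorem dfaNMnotPM_mem : (⟨Fin 4, dfaNMnotPM.accepts⟩ : (α : Type) × Language α) ∈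
    classNM \ classPM :=
  ⟨⟨inferInstance, inferInstance, isRegular_accepts _,
    (DFA.isNearlyMonotonic_toDFA_iff dfaNMnotPM_reachable dfaNMnotPM_minimal).2
      dfaNMnotPM_isNearlyMonotonic⟩,
    fun h => dfaNMnotPM_not_isPartiallyMonotonic
      ((DFA.isPartiallyMonotonic_toDFA_iff dfaNMnotPM_reachable dfaNMnotPM_minimal).1 h.2.2.2)⟩

theorem dfaSFnotNM_mem : (⟨Fin 2, dfaSFnotNM.accepts⟩ : (α : Type) × Language α) ∈
    classSF \ classNM :=
  ⟨⟨inferInstance, inferInstance, dfaSFnotNM_isStarFree⟩,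
    fun h => dfaSFnotNM_not_isNearlyMonotonic
      ((DFA.isNearlyMonotonic_toDFA_iff dfaSFnotNM_reachable dfaSFnotNM_minimal).1 h.2.2.2)⟩

theorem mainTheorem10 :
    (classM ⊂ classPM ∧ classPM ⊂ classNM ∧ classNM ⊂ classSF) ∧
    (⟨Fin 3, dfaPMnotM.accepts⟩ : (α : Type) × Language α) ∈ classPM \ classM ∧
    (⟨Fin 4, dfaNMnotPM.accepts⟩ : (α : Type) × Language α) ∈ classNM \ classPM ∧
    (⟨Fin 2, dfaSFnotNM.accepts⟩ : (α : Type) × Language α) ∈ classSF \ classNM :=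
  ⟨⟨⟨classM_subset_classPM, Set.not_subset.2 ⟨_, dfaPMnotM_mem⟩⟩,
    ⟨classPM_subset_classNM, Set.not_subset.2 ⟨_, dfaNMnotPM_mem⟩⟩,
    ⟨classNM_subset_classSF, Set.not_subset.2 ⟨_, dfaSFnotNM_mem⟩⟩⟩,
    dfaPMnotM_mem, dfaNMnotPM_mem, dfaSFnotNM_mem⟩
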